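/- Let $(K,\nu)$ be a valued field, $\overline{K}$ an algebraic closure of $K$, and $\omega$ an extension of $\nu$ to the rational function field $K(x)$. Valuations are written additively. For a valuation $\overline{\omega}$ of $\overline{K}(x)$, a pair $(a,\gamma)$ with $a\in\overline{K}$, $\gamma\in\overline{\omega}\,\overline{K}(x)$ is called a *pair of definition* for $\overline{\omega}$ if $$\overline{\omega}\Big(\sum_i c_i(x-a)^i\Big)=\min_i\big(\overline{\omega}c_i+i\gamma\big)\qquad\text{for all polynomials } \sum_i c_i(x-a)^i\in\overline{K}[x],$$ and a *minimal pair of definition* (over $K$) if moreover $[K(a):K]\le[K(b):K]$ for every $b\in\overline{K}$ with $\overline{\omega}(a-b)\ge\gamma$. (If such a pair exists for an extension $\overline{\omega}$ of $\omega$, then $\omega$ is valuation transcendental over $\nu$; the valued field $(K(a),\overline{\omega}|_{K(a)})$ is then called a minimal field of definition for $\omega$.) For a subfield $L$ of a field with valuation $v$, write $vL$ and $Lv$ for the value group and the residue field of $(L,v|_L)$. **Proposition 4.2 (with its corollary).** Let $\overline{\omega}$ and $\overline{\omega}'$ be two extensions of $\omega$ to $\overline{K}(x)$ (with values in a common ordered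 abelian group), with minimal pairs of definition $(a,\gamma)$ and $(a',\gamma')$ respectively (for instance with $\gamma=\gamma'$). Then: 1. $(\overline{\omega}K(a):\nu K)=(\overline{\omega}'K(a'):\nu K)$. 2. $K(a)\overline{\omega}=K(a')\overline{\omega}'$ as subfields of $K(x)\omega$; that is, there is a subfield $k$ of $K(x)\omega$ whose image under the canonical embedding $K(x)\omega\to\overline{K}(x)\overline{\omega}$ is $K(a)\overline{\omega}$ and whose image under the canonical embedding $K(x)\omega\to\overline{K}(x)\overline{\omega}'$ is $K(a')\overline{\omega}'$. 3. $(K(a)|K,\overline{\omega})$ is immediate if and only if $(K(a')|K,\overline{\omega}')$ is immediate. 4. If $(K,\nu)$ is henselian, then $(K(a)|K,\overline{\omega})$ is defectless (respectively tame, respectively purely wild) if and only if $(K(a')|K,\overline{\omega}')$ is. Consequently, if one minimal field of definition for $\omega$ has one of these properties (the last three over henselian $K$), then all have it. Here an extension $(L|K,v)$ is *immediate* if $vL=vK$ and $Lv=Kv$; a finite extension is *defectless* if $[L:K]=(vL:vK)[Lv:Kv]$; an algebraic extension $(L|K,v)$ is *tame* if for every finite subextension $E|K$ the characteristic of $Kv$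 does not divide $(vE:vK)$, $Ev|Kv$ is separable and $(E|K,v)$ is defectless; it is *purely wild* if $vL/vK$ is a $p$-group and $Lv|Kv$ is purely inseparable, where $p$ is the characteristic exponent of $Kv$ (so $vL=vK$ if $p=1$). -/

import Mathlib

open Polynomial IntermediateField

/-! Valuations are written multiplicatively, as in Mathlib: `v x ≤ 1` means that the additive value
of `x` is `≥ 0`, minima of additive values become maxima, and `γ ^ i` stands for `i γ`. -/

section ValuedFields

variable {Γ₀ : Type*} [LinearOrderedCommGroupWithZero Γ₀]

/-- For valued fields `(E, w)` and `(F, v)` and an embedding `φ : E → F` with `v ∘ φ = w`, the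
induced map of valuation rings. -/
def valuationRingMap {E F : Type*} [Field E] [Field F] (w : Valuation E Γ₀) (v : Valuation F Γ₀)
    (φ : E →+* F) (h : v.comap φ = w) : w.valuationSubring →+* v.valuationSubring where
  toFun u := ⟨φ u, by
    have hu : w u ≤ 1 := u.2
    exact (congrArg (fun z : Valuation E Γ₀ => z u) h).trans_le hu⟩
  map_one' := Subtype.ext (map_one φ)
  map_zero' := Subtype.ext (map_zero φ)
  map_mul' _ _ := Subtype.ext (map_mul φ _ _)
  map_add' _ _ := Subtype.ext (map_add φ _ _)

theorem isLocalHom_valuationRingMap {E F : Type*} [Field E] [Field F] (w : Valuation E Γ₀)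
    (v : Valuation F Γ₀) (φ : E →+* F) (h : v.comap φ = w) :
    IsLocalHom (valuationRingMap w v φ h) := by
  subst h
  constructor
  intro u hu
  obtain ⟨t, ht⟩ := isUnit_iff_exists_inv.mp hu
  have h1 : φ u * (t : F) = 1 := congrArg Subtype.val ht
  have hu0 : φ (u : E) ≠ 0 := left_ne_zero_of_mul_eq_one h1
  have hu0' : (u : E) ≠ 0 := fun h0 => hu0 (by rw [h0, map_zero])
  refine isUnit_iff_exists_inv.mpr ⟨⟨(u : E)⁻¹, ?_⟩, Subtype.ext (mul_inv_cancel₀ hu0')⟩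
  have ht' : (t : F) = φ ((u : E)⁻¹) := by
    rw [map_inv₀]
    exact eq_inv_of_mul_eq_one_right h1
  have h2 : v (t : F) ≤ 1 := t.2
  rw [ht'] at h2
  exact h2

/-- The canonical embedding `E w → F v` of residue fields induced by an extension of valued
fields `φ : (E, w) → (F, v)`. -/
noncomputable def residueMap {E F : Type*} [Field E] [Field F] (w : Valuation E Γ₀)
    (v : Valuation F Γ₀) (φ : E →+* F) (h : v.comap φ = w) :
    IsLocalRing.ResidueField w.valuationSubring →+*
      IsLocalRing.ResidueField v.valuationSubring :=
  haveI := isLocalHom_valuationRingMap w v φ h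
  IsLocalRing.ResidueField.map (valuationRingMap w v φ h)

variable {K F : Type*} [Field K] [Field F] [Algebra K F]

/-- The value group `v L` of a subfield `L` of the valued field `(F, v)`, as a subgroup of the
ambient ordered group. -/
def valueGroupOf (v : Valuation F Γ₀) (L : IntermediateField K F) : Subgroup Γ₀ˣ :=
  MonoidWithZeroHom.valueGroup (v.comap (algebraMap L F)).toMonoidWithZeroHom

/-- The residue field `L v` of a subfield `L` of the valued field `(F, v)`, as a subfield of
the residue field `F v`. -/
noncomputable def residueFieldOf (v : Valuation F Γ₀) (L : IntermediateField K F) :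
    Subfield (IsLocalRing.ResidueField v.valuationSubring) :=
  (residueMap (v.comap (algebraMap L F)) v (algebraMap L F) rfl).fieldRange

theorem residueFieldOf_mono (v : Valuation F Γ₀) {L M : IntermediateField K F} (h : L ≤ M) :
    residueFieldOf v L ≤ residueFieldOf v M := by
  rintro _ ⟨y, rfl⟩
  obtain ⟨u, rfl⟩ := IsLocalRing.residue_surjective y
  exact ⟨IsLocalRing.residue _ ⟨⟨(u : L), h (u : L).2⟩, u.2⟩, rfl⟩

/-- The residue field extension `L v | K v`, where `K` is identified with the smallest
intermediate field `⊥` of `F | K`. -/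
noncomputable def residueExtension (v : Valuation F Γ₀) (L : IntermediateField K F) :
    IntermediateField (residueFieldOf v (⊥ : IntermediateField K F))
      (IsLocalRing.ResidueField v.valuationSubring) :=
  Subfield.extendScalars (residueFieldOf_mono v (bot_le : ⊥ ≤ L))

/-- The ramification index `(v L : v K)`. -/
noncomputable def ramificationIndex (v : Valuation F Γ₀) (L : IntermediateField K F) : ℕ :=
  (valueGroupOf v (⊥ : IntermediateField K F)).relIndex (valueGroupOf v L)

/-- The inertia degree `[L v : K v]`. -/
noncomputable def inertiaDegree (v : Valuation F Γ₀) (L : IntermediateField K F) : ℕ :=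
  Module.finrank (residueFieldOf v (⊥ : IntermediateField K F)) (residueExtension v L)

/-- `(L | K, v)` is immediate: neither the value group nor the residue field is extended. -/
def IsImmediateExt (v : Valuation F Γ₀) (L : IntermediateField K F) : Prop :=
  valueGroupOf v L = valueGroupOf v (⊥ : IntermediateField K F) ∧
    residueFieldOf v L = residueFieldOf v (⊥ : IntermediateField K F)

/-- `(L | K, v)` is defectless: `L | K` is finite and the fundamental inequality is an
equality, `[L : K] = (v L : v K) [L v : K v]`. -/
def IsDefectlessExt (v : Valuation F Γ₀) (L : IntermediateField K F) : Prop :=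
  FiniteDimensional K L ∧ Module.finrank K L = ramificationIndex v L * inertiaDegree v L

/-- `(L | K, v)` is tame: it is algebraic and every finite subextension `E | K` has ramification
index not divisible by the residue characteristic, has a separable residue field extension, and is
defectless. -/
def IsTameExt (v : Valuation F Γ₀) (L : IntermediateField K F) : Prop :=
  Algebra.IsAlgebraic K L ∧
    ∀ E : IntermediateField K F, E ≤ L → FiniteDimensional K E →
      ¬ ringChar (residueFieldOf v (⊥ : IntermediateField K F)) ∣ ramificationIndex v E ∧
      Algebra.IsSeparable (residueFieldOf v (⊥ : IntermediateField K F)) (residueExtension v E) ∧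
      IsDefectlessExt v E

/-- `(L | K, v)` is purely wild: it is algebraic, `v L / v K` is a `p`-group, where `p` is the
characteristic exponent of `K v` (so `v L = v K` if `p = 1`), and `L v | K v` is purely
inseparable. -/
def IsPurelyWildExt (v : Valuation F Γ₀) (L : IntermediateField K F) : Prop :=
  Algebra.IsAlgebraic K L ∧
    IsPGroup (ringExpChar (residueFieldOf v (⊥ : IntermediateField K F)))
      (valueGroupOf v L ⧸
        (valueGroupOf v (⊥ : IntermediateField K F)).subgroupOf (valueGroupOf v L)) ∧
    IsPurelyInseparable (residueFieldOf v (⊥ : IntermediateField K F)) (residueExtension v L)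

end ValuedFields

section MinimalPairs

variable {Γ₀ : Type*} [LinearOrderedCommGroupWithZero Γ₀]

/-- The inclusion `K(x) → K̄(x)` extending `K → K̄` and sending `x` to `x`. -/
noncomputable def ratFuncInclusion (K Kbar : Type*) [Field K] [Field Kbar] [Algebra K Kbar] :
    RatFunc K →+* RatFunc Kbar :=
  RatFunc.mapRingHom (Polynomial.mapRingHom (algebraMap K Kbar))
    (nonZeroDivisors_le_comap_nonZeroDivisors_of_injective _
      (Polynomial.map_injective _ (algebraMap K Kbar).injective))

/-- The function `v_{a,γ}` on polynomials: if `f = ∑ cᵢ (x - a) ^ i`, its additive value at `f` is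
`min (v cᵢ + i γ)`. The coefficients `cᵢ` are those of `taylor a f = f (x + a)`. -/
noncomputable def monomialValue {L : Type*} [Field L] (v : Valuation L Γ₀) (a : L) (γ : Γ₀)
    (f : L[X]) : Γ₀ :=
  (taylor a f).support.sup fun i => v ((taylor a f).coeff i) * γ ^ i

/-- `(a, γ)` is a pair of definition for the valuation `w` of `L(x)`: `w = v_{a,γ}`, where `v` is
the restriction of `w` to `L`. -/
def IsPairOfDefinition {L : Type*} [Field L] (w : Valuation (RatFunc L) Γ₀) (a : L) (γ : Γ₀) :
    Prop :=
  ∀ f : L[X], w (algebraMap L[X] (RatFunc L) f) =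
    monomialValue (w.comap (algebraMap L (RatFunc L))) a γ f

/-- `(a, γ)` is a minimal pair of definition over `K` for the valuation `w` of `K̄(x)`: it is a pair
of definition, and `[K(a) : K] ≤ [K(b) : K]` for every `b ∈ K̄` such that the additive value of
`a - b` is `≥ γ`. -/
def IsMinimalPair (K : Type*) {Kbar : Type*} [Field K] [Field Kbar] [Algebra K Kbar]
    (w : Valuation (RatFunc Kbar) Γ₀) (a : Kbar) (γ : Γ₀) : Prop :=
  IsPairOfDefinition w a γ ∧
    ∀ b : Kbar, w (algebraMap Kbar (RatFunc Kbar) (a - b)) ≤ γ →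
      Module.finrank K K⟮a⟯ ≤ Module.finrank K K⟮b⟯

/-- The field `K(a)`, for `a ∈ K̄`, as a subfield of `K̄(x)`. -/
noncomputable def simpleExt (K : Type*) {Kbar : Type*} [Field K] [Field Kbar] [Algebra K Kbar]
    (a : Kbar) : IntermediateField K (RatFunc Kbar) :=
  K⟮algebraMap Kbar (RatFunc Kbar) a⟯

end MinimalPairs

/-! Put `n = [K(a) : K]` and let `f` be a nonzero polynomial over `K` of degree less than `n`. Each
root `b` of `f` has degree less than `n` over `K`, so minimality of the pair forces `w (a - b) > γ =
w (x - a)`. Thus `x - b` and `a - b` have the same leading term, and multiplying over the roots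
shows that `f` and `f(a)` do too (`IsMinimalPair.map_sub_aeval_lt`). Every element of `K(a)` has the
form `f(a)` with `deg f < n`, so the value group and residue field of `K(a)` are the values and
residues under `ω` of the polynomials of degree less than `n`. They depend on `ω` and `n` alone.

The degree `n` is itself an invariant of `ω` (`IsMinimalPair.finrank_le`). Suppose `n < [K(a') :
K]`, and let `Q` be the minimal polynomial of `a` and `P` that of `Q(a')`. For `w'`, `Q` is close to
the root `Q(a')` of `P`, so the terms of `P(Q)` cancel. For `w`, `Q` vanishes at `a`, so no constant
subtracted from `Q` causes cancellation, and `P(Q)` has at least its Gauss value. Both valuations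
restrict to `ω`, a contradiction.

The properties in the statement are determined by the degree, the value groups and the residue
fields. For tameness, which involves all subextensions, this rests on the fundamental inequality and
multiplicativity (`isTameExt_iff_of_finite`). -/

/-! ### Fundamental inequality and tameness of finite extensions -/

section ValuedFields

variable {Γ₀ : Type*} [LinearOrderedCommGroupWithZero Γ₀] {K F : Type*} [Field K] [Field F]
  [Algebra K F]

theorem mem_residueFieldOf_iff {v : Valuation F Γ₀} {L : IntermediateField K F}
    {z : IsLocalRing.ResidueField v.valuationSubring} :
    z ∈ residueFieldOf v L ↔
      ∃ u : v.valuationSubring, (u : F) ∈ L ∧ IsLocalRing.residue _ u = z := by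
  constructor
  · rintro ⟨y, rfl⟩
    obtain ⟨u, rfl⟩ := IsLocalRing.residue_surjective y
    exact ⟨⟨((u : L) : F), u.2⟩, (u : L).2, rfl⟩
  · rintro ⟨u, hu, rfl⟩
    exact ⟨IsLocalRing.residue _ ⟨⟨(u : F), hu⟩, u.2⟩, rfl⟩

theorem mem_valueGroupOf_iff {v : Valuation F Γ₀} {L : IntermediateField K F} {g : Γ₀ˣ} :
    g ∈ valueGroupOf v L ↔ ∃ u ∈ L, v u = g := by
  rw [valueGroupOf, MonoidWithZeroHom.mem_valueGroup_iff_of_comm]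
  constructor
  · rintro ⟨a, ha, x, hx⟩
    refine ⟨(x : F) * (a : F)⁻¹, L.mul_mem x.2 (L.inv_mem a.2), ?_⟩
    change v (a : F) ≠ 0 at ha
    change v (a : F) * g = v (x : F) at hx
    rw [map_mul, map_inv₀, ← hx, mul_comm, inv_mul_cancel_left₀ ha]
  · rintro ⟨u, hu, h⟩
    refine ⟨1, by simp, ⟨u, hu⟩, ?_⟩
    change v ((1 : L) : F) * g = v u
    simp [h]

theorem valueGroupOf_mono (v : Valuation F Γ₀) {L M : IntermediateField K F} (h : L ≤ M) :
    valueGroupOf v L ≤ valueGroupOf v M := by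
  intro g hg
  obtain ⟨u, hu, e⟩ := mem_valueGroupOf_iff.mp hg
  exact mem_valueGroupOf_iff.mpr ⟨u, h hu, e⟩

theorem inertiaDegree_eq_relfinrank (v : Valuation F Γ₀) (L : IntermediateField K F) :
    inertiaDegree v L =
      (residueFieldOf v (⊥ : IntermediateField K F)).relfinrank (residueFieldOf v L) :=
  (Subfield.relfinrank_eq_finrank_of_le _).symm

/-- Elements of the valuation ring with linearly independent residues form a valuation
independent family. -/
theorem exists_valuation_sum_eq (v : Valuation F Γ₀) (A : IntermediateField K F) {κ : Type*}
    [Fintype κ] (y : κ → v.valuationSubring)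
    (hy : LinearIndependent (residueFieldOf v A) fun j => IsLocalRing.residue _ (y j))
    (c : κ → F) (hc : ∀ j, c j ∈ A) (hne : ∃ j, c j ≠ 0) :
    ∃ j, c j ≠ 0 ∧ v (∑ i, c i * y i) = v (c j) := by
  obtain ⟨j', hj'⟩ := hne
  obtain ⟨j, -, hj⟩ := Finset.exists_max_image Finset.univ (fun i => v (c i)) ⟨j', Finset.mem_univ _⟩
  have hvj : v (c j) ≠ 0 := by
    intro h0
    have := hj j' (Finset.mem_univ _)
    rw [h0, le_zero_iff, map_eq_zero] at this
    exact hj' this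
  have hcj : c j ≠ 0 := fun h => hvj (by rw [h, map_zero])
  refine ⟨j, hcj, ?_⟩
  -- Division by a coefficient of largest value makes all coefficients integral and the `j`-th equal
  -- to 1. If the sum had residue zero, this would be a nontrivial relation between the residues.
  let d : κ → v.valuationSubring := fun i => ⟨c i * (c j)⁻¹, by
    change v _ ≤ 1
    rw [map_mul, map_inv₀, ← div_eq_mul_inv]
    exact div_le_one_of_le₀ (hj i (Finset.mem_univ _)) zero_le⟩
  have hd : ∀ i, IsLocalRing.residue _ (d i) ∈ residueFieldOf v A := fun i =>
    mem_residueFieldOf_iff.mpr ⟨d i, A.mul_mem (hc i) (A.inv_mem (hc j)), rfl⟩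
  have hdj : d j = 1 := Subtype.ext (mul_inv_cancel₀ hcj)
  set t : v.valuationSubring := ∑ i, d i * y i with ht
  have hres : IsLocalRing.residue _ t ≠ 0 := by
    intro h0
    have h1 := Fintype.linearIndependent_iff.mp hy (fun i => ⟨_, hd i⟩) (by
      rw [← h0, ht, map_sum]
      refine Finset.sum_congr rfl fun i _ => ?_
      rw [map_mul]
      rfl) j
    have h2 : IsLocalRing.residue _ (d j) = 0 := congrArg Subtype.val h1
    rw [hdj, map_one] at h2
    exact one_ne_zero h2
  have hunit : IsUnit t := by
    by_contra hn
    exact hres ((IsLocalRing.residue_eq_zero_iff t).mpr hn)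
  have hvt : v (t : F) = 1 := (Valuation.Integers.isUnit_iff_valuation_eq_one
    (Valuation.integer.integers v)).mp hunit
  have hsum : ∑ i, c i * (y i : F) = c j * t := by
    rw [ht]
    push_cast
    rw [Finset.mul_sum]
    refine Finset.sum_congr rfl fun i _ => ?_
    change _ = c j * (c i * (c j)⁻¹ * (y i : F))
    field_simp
  rw [hsum, map_mul, hvt, mul_one]

/-- Products of representatives of distinct classes of values with elements whose residues are
linearly independent are linearly independent. -/
theorem linearIndependent_mul_of_valuation (v : Valuation F Γ₀) (A : IntermediateField K F)
    {ι κ : Type*} [Fintype ι] [Fintype κ] (x : ι → F) (hx0 : ∀ i, x i ≠ 0)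
    (hx : ∀ i j, ∀ c ∈ A, v c * v (x i) = v (x j) → i = j) (y : κ → v.valuationSubring)
    (hy : LinearIndependent (residueFieldOf v A) fun j => IsLocalRing.residue _ (y j)) :
    LinearIndependent A fun p : ι × κ => x p.1 * (y p.2 : F) := by
  classical
  rw [Fintype.linearIndependent_iff]
  intro c hc
  by_contra! hne
  obtain ⟨⟨i₁, j₁⟩, h₁⟩ := hne
  set s : ι → F := fun i => ∑ j, (c (i, j) : F) * y j with hs
  have key : ∀ i, (∃ j, (c (i, j) : F) ≠ 0) → ∃ d ∈ A, d ≠ 0 ∧ v (s i) = v d := fun i hi => by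
    obtain ⟨j, hj, e⟩ := exists_valuation_sum_eq v A y hy (fun j => (c (i, j) : F))
      (fun j => (c (i, j)).2) hi
    exact ⟨_, (c (i, j)).2, hj, e⟩
  have hzero : ∑ i, x i * s i = 0 := by
    rw [← hc, Fintype.sum_prod_type]
    refine Finset.sum_congr rfl fun i _ => ?_
    rw [hs, Finset.mul_sum]
    refine Finset.sum_congr rfl fun j _ => ?_
    rw [Algebra.smul_def]
    change x i * ((c (i, j) : F) * y j) = (c (i, j) : F) * (x i * y j)
    ring
  obtain ⟨i₀, -, hi₀⟩ := Finset.exists_max_image Finset.univ (fun i => v (x i * s i))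
    ⟨i₁, Finset.mem_univ _⟩
  have hpos : v (x i₀ * s i₀) ≠ 0 := by
    intro h0
    have h2 := hi₀ i₁ (Finset.mem_univ _)
    obtain ⟨d, -, hd0, hd⟩ := key i₁ ⟨j₁, fun h => h₁ (Subtype.ext h)⟩
    rw [h0, le_zero_iff, map_mul, hd, mul_eq_zero, map_eq_zero, map_eq_zero] at h2
    exact h2.elim (hx0 _) hd0
  have key' : ∀ i, v (x i * s i) ≠ 0 → ∃ d ∈ A, d ≠ 0 ∧ v (s i) = v d := fun i hi => by
    refine key i ?_
    by_contra! h
    refine hi ?_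
    simp [hs, h]
  -- The values of the `s i` in question come from `A`, so equality would put `x i` and `x i₀` in
  -- the same class of values. Hence one term strictly dominates and the sum cannot vanish.
  have hlt : ∀ i ∈ Finset.univ \ {i₀}, v (x i * s i) < v (x i₀ * s i₀) := by
    intro i hi
    have hii : i ≠ i₀ := by simpa using hi
    refine lt_of_le_of_ne (hi₀ i (Finset.mem_univ _)) fun he => hii ?_
    obtain ⟨d, hdA, hd0, hd⟩ := key' i (he ▸ hpos)
    obtain ⟨d', hdA', hd0', hd'⟩ := key' i₀ hpos
    refine hx i i₀ (d * d'⁻¹) (A.mul_mem hdA (A.inv_mem hdA')) ?_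
    rw [map_mul, map_mul, hd, hd'] at he
    have hvd : v d' ≠ 0 := (Valuation.ne_zero_iff v).mpr hd0'
    rw [map_mul, map_inv₀]
    calc v d * (v d')⁻¹ * v (x i) = v (x i) * v d * (v d')⁻¹ := by ac_rfl
      _ = v (x i₀) := by rw [he, mul_inv_cancel_right₀ hvd]
  have := v.map_sum_eq_of_lt (Finset.mem_univ i₀) hlt
  rw [hzero, map_zero] at this
  exact hpos this.symm

/-- The fundamental inequality. -/
theorem relIndex_mul_relfinrank_le (v : Valuation F Γ₀) {A B : IntermediateField K F} (h : A ≤ B)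
    (hfin : IntermediateField.relfinrank A B ≠ 0) :
    (valueGroupOf v A).relIndex (valueGroupOf v B) *
      (residueFieldOf v A).relfinrank (residueFieldOf v B) ≤
        IntermediateField.relfinrank A B := by
  classical
  set VA := valueGroupOf v A
  set VB := valueGroupOf v B
  rw [IntermediateField.relfinrank_eq_finrank_of_le h] at hfin ⊢
  rw [Subfield.relfinrank_eq_finrank_of_le (residueFieldOf_mono v h)]
  set RB := Subfield.extendScalars (residueFieldOf_mono v h)
  -- An infinite index or degree counts as 0, which makes the inequality trivial.
  by_cases he : VA.relIndex VB = 0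
  · simp [he]
  by_cases hf : Module.finrank (residueFieldOf v A) RB = 0
  · simp [hf]
  have : Module.Finite (residueFieldOf v A) RB := Module.finite_of_finrank_pos (by omega)
  have : Module.Finite A (IntermediateField.extendScalars h) :=
    Module.finite_of_finrank_pos (by omega)
  have : Finite (VB ⧸ VA.subgroupOf VB) := Nat.finite_of_card_ne_zero he
  have := Fintype.ofFinite (VB ⧸ VA.subgroupOf VB)
  choose x hxB hx using fun i : VB ⧸ VA.subgroupOf VB => mem_valueGroupOf_iff.mp i.out.2
  let b := Module.finBasis (residueFieldOf v A) RB
  choose y hyB hy using fun j => mem_residueFieldOf_iff.mp (b j).2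
  have hli := linearIndependent_mul_of_valuation v A x
    (fun i h0 => (Quotient.out i).1.ne_zero (by rw [← hx, h0, map_zero])) (by
      intro i j c hc hij
      rw [← QuotientGroup.out_eq' i, ← QuotientGroup.out_eq' j, QuotientGroup.eq,
        Subgroup.mem_subgroupOf]
      refine mem_valueGroupOf_iff.mpr ⟨c, hc, ?_⟩
      rw [hx, hx] at hij
      push_cast
      rw [← hij]
      field_simp
      ) y (by
      simp only [hy]
      exact b.linearIndependent.map' RB.val.toLinearMap
        (LinearMap.ker_eq_bot.mpr Subtype.val_injective))
  have hli' : LinearIndependent A fun p : (VB ⧸ VA.subgroupOf VB) × Fin _ =>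
      (⟨x p.1 * (y p.2 : F), B.mul_mem (hxB _) (hyB _)⟩ : IntermediateField.extendScalars h) :=
    LinearIndependent.of_comp (IntermediateField.extendScalars h).val.toLinearMap hli
  have := hli'.fintype_card_le_finrank
  rw [Fintype.card_prod, Fintype.card_fin, ← Nat.card_eq_fintype_card] at this
  exact this

/-- A finite extension is tame as soon as the conditions of tameness hold for the extension itself:
they are inherited by subextensions. -/
theorem isTameExt_iff_of_finite (v : Valuation F Γ₀) (L : IntermediateField K F)
    [FiniteDimensional K L] :
    IsTameExt v L ↔
      ¬ ringChar (residueFieldOf v (⊥ : IntermediateField K F)) ∣ ramificationIndex v L ∧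
      Algebra.IsSeparable (residueFieldOf v (⊥ : IntermediateField K F)) (residueExtension v L) ∧
      IsDefectlessExt v L := by
  refine ⟨fun h => h.2 L le_rfl inferInstance, ?_⟩
  rintro ⟨hp, hsep, -, hd⟩
  refine ⟨inferInstance, fun E hE hEfin => ?_⟩
  have he := Subgroup.relIndex_mul_relIndex _ _ _ (valueGroupOf_mono v (bot_le : ⊥ ≤ E))
    (valueGroupOf_mono v hE)
  have hf := Subfield.relfinrank_mul_relfinrank (residueFieldOf_mono v (bot_le : ⊥ ≤ E))
    (residueFieldOf_mono v hE)
  have hn := IntermediateField.finrank_bot_mul_relfinrank hE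
  refine ⟨fun hdvd => hp (hdvd.trans ⟨_, he.symm⟩), ?_, hEfin, ?_⟩
  · have hle : residueExtension v E ≤ residueExtension v L := residueFieldOf_mono v hE
    exact Algebra.IsSeparable.of_algHom _ _ (IntermediateField.inclusion hle)
  · have hLpos : 0 < Module.finrank K L := Module.finrank_pos
    have hEpos : 0 < Module.finrank K E := Module.finrank_pos
    have hrel : IntermediateField.relfinrank E L ≠ 0 := fun h0 => by
      rw [h0, mul_zero] at hn
      omega
    have i1 := relIndex_mul_relfinrank_le v hE hrel
    have i2 := relIndex_mul_relfinrank_le v (bot_le : ⊥ ≤ E) (by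
      rw [IntermediateField.relfinrank_bot_left]; omega)
    rw [IntermediateField.relfinrank_bot_left] at i2
    rw [inertiaDegree_eq_relfinrank, ramificationIndex] at hd ⊢
    rw [← hn, ← he, ← hf] at hd
    -- Equality for `L | K` and the inequality for `L | E` give `[E : K] [L : E] ≤ e f [L : E]`,
    -- with `e`, `f` those of `E | K`; then `[L : E]` is cancelled.
    refine le_antisymm ?_ i2
    refine Nat.le_of_mul_le_mul_right ?_ (Nat.pos_of_ne_zero hrel)
    rw [hd]
    calc _ = _ * _ := mul_mul_mul_comm _ _ _ _
      _ ≤ _ := Nat.mul_le_mul_left _ i1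

end ValuedFields

/-! ### Leading terms, Gauss values and residues -/

section ValuationEstimates

variable {Γ₀ : Type*} [LinearOrderedCommGroupWithZero Γ₀]

/-- The hypotheses say that `x`, `x'` and `y`, `y'` have the same leading terms, and leading terms
multiply. -/
theorem Valuation.mul_sub_mul_lt {R : Type*} [CommRing R] (v : Valuation R Γ₀) {x x' y y' : R}
    (hx : v (x - x') < v x') (hy : v (y - y') < v y') : v (x * y - x' * y') < v (x' * y') := by
  have e : x * y - x' * y' = (x - x') * y + x' * (y - y') := by ring
  have hx0 : 0 < v x' := zero_le.trans_lt hx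
  have hy0 : 0 < v y' := zero_le.trans_lt hy
  rw [e]
  refine v.map_add_lt ?_ ?_
  · rw [map_mul, map_mul, v.map_eq_of_sub_lt hy]
    exact mul_lt_mul_of_pos_right hx hy0
  · rw [map_mul, map_mul]
    exact mul_lt_mul_of_pos_left hy hx0

theorem Valuation.pow_sub_pow_lt {R : Type*} [CommRing R] (v : Valuation R Γ₀) {x y : R}
    (h : v (x - y) < v y) (i : ℕ) : v (x ^ i - y ^ i) < v (y ^ i) := by
  induction i with
  | zero => simp
  | succ i ih =>
    rw [pow_succ, pow_succ]
    exact v.mul_sub_mul_lt ih h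

theorem Valuation.multiset_prod_sub_prod_lt {R ι : Type*} [CommRing R] (v : Valuation R Γ₀)
    (s : Multiset ι) (f g : ι → R) (h : ∀ i ∈ s, v (f i - g i) < v (g i)) :
    v ((s.map f).prod - (s.map g).prod) < v (s.map g).prod := by
  induction s using Multiset.induction with
  | empty => simp
  | cons i s ih =>
    rw [Multiset.map_cons, Multiset.map_cons, Multiset.prod_cons, Multiset.prod_cons]
    exact v.mul_sub_mul_lt (h i (Multiset.mem_cons_self _ _))
      (ih fun j hj => h j (Multiset.mem_cons_of_mem hj))

/-- The Gauss value of a product of linear polynomials is at most the product of the Gauss values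
of the factors. -/
theorem Valuation.coeff_multiset_prod_X_sub_C_le {L : Type*} [CommRing L] (v : Valuation L Γ₀)
    (δ : Γ₀) (s : Multiset L) (i : ℕ) :
    v ((s.map fun r => X - C r).prod.coeff i) * δ ^ i ≤ (s.map fun r => max δ (v r)).prod := by
  induction s using Multiset.induction generalizing i with
  | empty => by_cases hi : i = 0 <;> simp [coeff_one, hi]
  | cons r s ih =>
    simp only [Multiset.map_cons, Multiset.prod_cons]
    set p := (s.map fun r => X - C r).prod
    set M := (s.map fun r => max δ (v r)).prod
    have h2 : ∀ i, v (r * p.coeff i) * δ ^ i ≤ max δ (v r) * M := fun i => by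
      rw [map_mul, mul_assoc]
      exact mul_le_mul' (le_max_right _ _) (ih i)
    cases i with
    | zero =>
      rw [sub_mul, coeff_sub, coeff_X_mul_zero, coeff_C_mul, zero_sub, Valuation.map_neg]
      exact h2 0
    | succ i =>
      rw [sub_mul, coeff_sub, coeff_X_mul, coeff_C_mul]
      have h1 : v (p.coeff i) * δ ^ (i + 1) ≤ max δ (v r) * M := by
        rw [pow_succ, ← mul_assoc, mul_comm]
        exact mul_le_mul' (le_max_left _ _) (ih i)
      rcases le_max_iff.mp (v.map_sub (p.coeff i) (r * p.coeff (i + 1))) with h | h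
      · exact (mul_le_mul_left h _).trans h1
      · exact (mul_le_mul_left h _).trans (h2 (i + 1))

theorem residue_eq_zero_iff_lt {F : Type*} [Field F] {v : Valuation F Γ₀}
    (u : v.valuationSubring) : IsLocalRing.residue _ u = 0 ↔ v (u : F) < 1 := by
  rw [IsLocalRing.residue_eq_zero_iff, IsLocalRing.mem_maximalIdeal, mem_nonunits_iff]
  have := Valuation.Integers.isUnit_iff_valuation_eq_one (Valuation.integer.integers v) (x := u)
  exact (not_congr this).trans ⟨fun h => lt_of_le_of_ne u.2 h, fun h => h.ne⟩

theorem residue_eq_of_sub_lt {F : Type*} [Field F] {v : Valuation F Γ₀}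
    {s t : v.valuationSubring} (h : v ((s : F) - t) < 1) :
    IsLocalRing.residue _ s = IsLocalRing.residue _ t := by
  rw [← sub_eq_zero, ← map_sub, residue_eq_zero_iff_lt]
  exact h

end ValuationEstimates

/-! ### Pairs of definition, and `K` seen through `ω` -/

section MinimalPairs

variable {Γ₀ : Type*} [LinearOrderedCommGroupWithZero Γ₀]

theorem monomialValue_le_iff {L : Type*} [Field L] {v : Valuation L Γ₀} {a : L} {γ : Γ₀}
    {f : L[X]} {t : Γ₀} :
    monomialValue v a γ f ≤ t ↔ ∀ i, v ((taylor a f).coeff i) * γ ^ i ≤ t := by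
  rw [monomialValue, Finset.sup_le_iff]
  refine ⟨fun h i => ?_, fun h i _ => h i⟩
  by_cases hi : (taylor a f).coeff i = 0
  · simp [hi]
  · exact h i (mem_support_iff.mpr hi)

theorem algebraMap_ratFunc_eq_C {L : Type*} [Field L] (c : L) :
    algebraMap L (RatFunc L) c = algebraMap L[X] (RatFunc L) (C c) :=
  IsScalarTower.algebraMap_apply L L[X] (RatFunc L) c

theorem IsPairOfDefinition.map_X_sub_C {L : Type*} [Field L] {w : Valuation (RatFunc L) Γ₀} {a : L}
    {γ : Γ₀} (h : IsPairOfDefinition w a γ) : w (algebraMap L[X] (RatFunc L) (X - C a)) = γ := by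
  rw [h, monomialValue]
  have : taylor a (X - C a) = X := by simp
  rw [this, support_X, Finset.sup_singleton]
  simp

/-- If `a` is a root of `f`, then subtracting a constant from `f` causes no cancellation. -/
theorem IsPairOfDefinition.map_sub_C {L : Type*} [Field L] {w : Valuation (RatFunc L) Γ₀} {a : L}
    {γ : Γ₀} (h : IsPairOfDefinition w a γ) {f : L[X]} (hf : f.eval a = 0) (r : L) :
    w (algebraMap L[X] (RatFunc L) f - algebraMap L (RatFunc L) r) =
      max (w (algebraMap L[X] (RatFunc L) f)) (w (algebraMap L (RatFunc L) r)) := by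
  have key := monomialValue_le_iff.mp (h (f - C r)).ge
  have e : algebraMap L[X] (RatFunc L) (f - C r) =
      algebraMap L[X] (RatFunc L) f - algebraMap L (RatFunc L) r := by
    rw [map_sub, algebraMap_ratFunc_eq_C]
  rw [e] at key
  refine le_antisymm (w.map_sub _ _) (max_le ?_ ?_)
  -- A constant changes only the zeroth Taylor coefficient at `a`, and that of `f` is `f(a) = 0`.
  · rw [h f, monomialValue_le_iff]
    intro i
    cases i with
    | zero => simp [taylor_coeff_zero, hf]
    | succ i => simpa [coeff_C] using key (i + 1)
  · simpa [taylor_coeff_zero, hf] using key 0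

variable {K Kbar : Type*} [Field K] [Field Kbar] [Algebra K Kbar]

theorem ratFuncInclusion_algebraMap (f : K[X]) :
    ratFuncInclusion K Kbar (algebraMap K[X] (RatFunc K) f) =
      algebraMap Kbar[X] (RatFunc Kbar) (f.map (algebraMap K Kbar)) := by
  have := RatFunc.map_apply_div (R := Kbar) (K := K) (F := K[X] →+* Kbar[X])
    (Polynomial.mapRingHom (algebraMap K Kbar))
    (nonZeroDivisors_le_comap_nonZeroDivisors_of_injective _
      (Polynomial.map_injective _ (algebraMap K Kbar).injective)) f 1
  simpa using! this

theorem ratFuncInclusion_algebraMap_base (c : K) :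
    ratFuncInclusion K Kbar (algebraMap K (RatFunc K) c) = algebraMap K (RatFunc Kbar) c := by
  rw [algebraMap_ratFunc_eq_C, ratFuncInclusion_algebraMap, map_C, ← algebraMap_ratFunc_eq_C,
    ← IsScalarTower.algebraMap_apply]

theorem simpleExt_eq_map (a : Kbar) :
    simpleExt K a = K⟮a⟯.map (IsScalarTower.toAlgHom K Kbar (RatFunc Kbar)) := by
  rw [adjoin_map, Set.image_singleton]
  rfl

theorem finrank_simpleExt (a : Kbar) :
    Module.finrank K (simpleExt K a) = Module.finrank K K⟮a⟯ := by
  rw [simpleExt_eq_map]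
  exact ((K⟮a⟯).equivMap _).toLinearEquiv.finrank_eq.symm

theorem mem_valueGroupOf_bot_iff {ω : Valuation (RatFunc K) Γ₀} {w : Valuation (RatFunc Kbar) Γ₀}
    (hw : w.comap (ratFuncInclusion K Kbar) = ω) {g : Γ₀ˣ} :
    g ∈ valueGroupOf w (⊥ : IntermediateField K (RatFunc Kbar)) ↔
      ∃ c : K, ω (algebraMap K (RatFunc K) c) = g := by
  subst hw
  rw [mem_valueGroupOf_iff]
  constructor
  · rintro ⟨u, hu, e⟩
    obtain ⟨c, rfl⟩ := IntermediateField.mem_bot.mp hu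
    exact ⟨c, by rw [Valuation.comap_apply, ratFuncInclusion_algebraMap_base, e]⟩
  · rintro ⟨c, e⟩
    exact ⟨_, IntermediateField.mem_bot.mpr ⟨c, rfl⟩, by
      rw [Valuation.comap_apply, ratFuncInclusion_algebraMap_base] at e
      exact e⟩

theorem coe_residueFieldOf_bot {ω : Valuation (RatFunc K) Γ₀} {w : Valuation (RatFunc Kbar) Γ₀}
    (hw : w.comap (ratFuncInclusion K Kbar) = ω) :
    (residueFieldOf w (⊥ : IntermediateField K (RatFunc Kbar)) :
      Set (IsLocalRing.ResidueField w.valuationSubring)) =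
      residueMap ω w (ratFuncInclusion K Kbar) hw '' (IsLocalRing.residue ω.valuationSubring ''
        {t | ∃ c : K, algebraMap K (RatFunc K) c = t}) := by
  subst hw
  ext z
  rw [SetLike.mem_coe, mem_residueFieldOf_iff]
  constructor
  · rintro ⟨u, hu, rfl⟩
    obtain ⟨c, e⟩ := IntermediateField.mem_bot.mp hu
    rw [← ratFuncInclusion_algebraMap_base] at e
    have hle : w (ratFuncInclusion K Kbar (algebraMap K (RatFunc K) c)) ≤ 1 := by
      rw [e]
      exact u.2
    exact ⟨_, ⟨⟨algebraMap K (RatFunc K) c, hle⟩, ⟨c, rfl⟩, rfl⟩,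
      congrArg (IsLocalRing.residue _) (Subtype.ext e)⟩
  · rintro ⟨_, ⟨t, ⟨c, e⟩, rfl⟩, rfl⟩
    refine ⟨valuationRingMap _ w (ratFuncInclusion K Kbar) rfl t, ?_, rfl⟩
    refine IntermediateField.mem_bot.mpr ⟨c, ?_⟩
    rw [← ratFuncInclusion_algebraMap_base, e]
    rfl

/-! ### Approximation by the value at `a`, and invariance of the degree -/

variable [IsAlgClosure K Kbar]

theorem IsAlgClosure.isIntegral (a : Kbar) : IsIntegral K a :=
  have := IsAlgClosure.isAlgebraic (R := K) (K := Kbar)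
  Algebra.IsIntegral.isIntegral a

/-- A polynomial over `K` of degree less than `[K(a) : K]` is close to its value at `a`. -/
theorem IsMinimalPair.map_sub_aeval_lt {w : Valuation (RatFunc Kbar) Γ₀} {a : Kbar} {γ : Γ₀}
    (h : IsMinimalPair K w a γ) {f : K[X]} (hf0 : f ≠ 0)
    (hf : f.natDegree < Module.finrank K K⟮a⟯) :
    w (ratFuncInclusion K Kbar (algebraMap K[X] (RatFunc K) f) -
        algebraMap Kbar (RatFunc Kbar) (aeval a f)) <
      w (algebraMap Kbar (RatFunc Kbar) (aeval a f)) := by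
  have := IsAlgClosure.isAlgClosed K (K := Kbar)
  set g := f.map (algebraMap K Kbar) with hg
  have hg0 : g ≠ 0 := (Polynomial.map_ne_zero_iff (algebraMap K Kbar).injective).mpr hf0
  have hsplit := (IsAlgClosed.splits g).eq_prod_roots
  have h1 : ratFuncInclusion K Kbar (algebraMap K[X] (RatFunc K) f) =
      algebraMap Kbar (RatFunc Kbar) g.leadingCoeff *
        (g.roots.map fun b => algebraMap Kbar[X] (RatFunc Kbar) (X - C b)).prod := by
    rw [ratFuncInclusion_algebraMap, ← hg]
    conv_lhs => rw [hsplit]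
    rw [map_mul, algebraMap_ratFunc_eq_C, map_multiset_prod, Multiset.map_map]
    rfl
  have h2 : algebraMap Kbar (RatFunc Kbar) (aeval a f) =
      algebraMap Kbar (RatFunc Kbar) g.leadingCoeff *
        (g.roots.map fun b => algebraMap Kbar (RatFunc Kbar) (a - b)).prod := by
    rw [← eval_map_algebraMap, ← hg, (IsAlgClosed.splits g).eval_eq_prod_roots, map_mul,
      map_multiset_prod, Multiset.map_map]
    rfl
  rw [h1, h2]
  refine w.mul_sub_mul_lt ?_ (w.multiset_prod_sub_prod_lt _ _ _ fun b hb => ?_)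
  · rw [sub_self, map_zero, zero_lt_iff, Valuation.ne_zero_iff, map_ne_zero_iff _
      (algebraMap Kbar (RatFunc Kbar)).injective]
    exact leadingCoeff_ne_zero.mpr hg0
  · have e : algebraMap Kbar[X] (RatFunc Kbar) (X - C b) - algebraMap Kbar (RatFunc Kbar) (a - b) =
        algebraMap Kbar[X] (RatFunc Kbar) (X - C a) := by
      rw [algebraMap_ratFunc_eq_C, ← map_sub]
      congr 1
      rw [C_sub]
      ring
    rw [e, h.1.map_X_sub_C]
    -- Otherwise minimality gives `[K(a) : K] ≤ [K(b) : K]`, but the minimal polynomial of `b`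
    -- divides `f`, whose degree is smaller.
    by_contra! hle
    have hn := h.2 b hle
    have hroot : aeval b f = 0 := by
      rw [← eval_map_algebraMap]
      exact (mem_roots'.mp hb).2
    rw [adjoin.finrank (IsAlgClosure.isIntegral (K := K) b)] at hn
    have := natDegree_le_of_dvd (minpoly.dvd K b hroot) hf0
    omega

/-- Minimal pairs of definition of two extensions of the same valuation generate extensions of the
same degree. Otherwise the minimal polynomial of the generator of smaller degree would behave like
an element algebraic over `K` for one of the extensions, and like a transcendental one for the
other. -/
theorem IsMinimalPair.finrank_le {ω : Valuation (RatFunc K) Γ₀} {w w' : Valuation (RatFunc Kbar) Γ₀}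
    (hw : w.comap (ratFuncInclusion K Kbar) = ω) (hw' : w'.comap (ratFuncInclusion K Kbar) = ω)
    {a a' : Kbar} {γ γ' : Γ₀} (h : IsMinimalPair K w a γ) (h' : IsMinimalPair K w' a' γ') :
    Module.finrank K K⟮a'⟯ ≤ Module.finrank K K⟮a⟯ := by
  have := IsAlgClosure.isAlgClosed K (K := Kbar)
  by_contra! hlt
  have hww' : ∀ y, w (ratFuncInclusion K Kbar y) = w' (ratFuncInclusion K Kbar y) := fun y =>
    congrArg (fun v : Valuation (RatFunc K) Γ₀ => v y) (hw.trans hw'.symm)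
  have ha := IsAlgClosure.isIntegral (K := K) a
  set Q := minpoly K a
  set q := ratFuncInclusion K Kbar (algebraMap K[X] (RatFunc K) Q) with hq
  set b := aeval a' Q
  set β := algebraMap Kbar (RatFunc Kbar) b
  have hclose : w' (q - β) < w' β := h'.map_sub_aeval_lt (minpoly.ne_zero ha)
    (by rwa [adjoin.finrank ha] at hlt)
  have hqβ : w' q = w' β := w'.map_eq_of_sub_lt hclose
  have hβ0 : w' β ≠ 0 := (zero_le.trans_lt hclose).ne'
  have hb := IsAlgClosure.isIntegral (K := K) b
  set P := minpoly K b
  set T := ratFuncInclusion K Kbar (algebraMap K[X] (RatFunc K) (P.comp Q))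
  let c : ℕ → RatFunc Kbar := fun i => algebraMap K (RatFunc Kbar) (P.coeff i)
  have hT : T = ∑ i ∈ Finset.range (P.natDegree + 1), c i * q ^ i := by
    change ratFuncInclusion K Kbar (algebraMap K[X] (RatFunc K) (P.comp Q)) = _
    rw [comp, eval₂_eq_sum_range, map_sum, map_sum]
    refine Finset.sum_congr rfl fun i _ => ?_
    rw [map_mul, map_mul, map_pow, map_pow, ← algebraMap_ratFunc_eq_C,
      ratFuncInclusion_algebraMap_base]
  have hPβ : ∑ i ∈ Finset.range (P.natDegree + 1), c i * β ^ i = 0 := by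
    have h0 : aeval b P = 0 := minpoly.aeval K b
    rw [aeval_eq_sum_range] at h0
    have := congrArg (algebraMap Kbar (RatFunc Kbar)) h0
    rw [map_zero, map_sum] at this
    rw [← this]
    refine Finset.sum_congr rfl fun i _ => ?_
    rw [Algebra.smul_def, map_mul, map_pow, ← IsScalarTower.algebraMap_apply]
  have hcw : ∀ i, w' (c i) = w (c i) := fun i => by
    have := hww' (algebraMap K (RatFunc K) (P.coeff i))
    rw [ratFuncInclusion_algebraMap_base] at this
    exact this.symm
  -- The maximum over `j` is the Gauss value of `P` at radius `w' β = w' q`; it is nonzero because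
  -- `P` is monic.
  obtain ⟨j, -, hj⟩ := Finset.exists_max_image (Finset.range (P.natDegree + 1))
    (fun i => w' (c i) * w' β ^ i) ⟨0, by simp⟩
  have hpos : 0 < w' (c j) * w' β ^ j := by
    refine lt_of_lt_of_le ?_ (hj P.natDegree (by simp))
    have : c P.natDegree = 1 := by
      change algebraMap K (RatFunc Kbar) P.leadingCoeff = 1
      rw [(minpoly.monic hb).leadingCoeff, map_one]
    rw [this, map_one, one_mul]
    exact zero_lt_iff.mpr (pow_ne_zero _ hβ0)
  -- Since `P(β) = 0`, `T` is the sum of the `c i * (q ^ i - β ^ i)`, each strictly below the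
  -- maximum.
  have hsmall : w' T < w' (c j) * w' β ^ j := by
    rw [← sub_zero T, ← hPβ, hT, ← Finset.sum_sub_distrib]
    refine w'.map_sum_lt hpos.ne' fun i hi => ?_
    rw [← mul_sub, map_mul]
    by_cases hc : w' (c i) = 0
    · rw [hc, zero_mul]
      exact hpos
    · refine lt_of_lt_of_le ?_ (hj i hi)
      have := mul_lt_mul_of_pos_left (w'.pow_sub_pow_lt hclose i) (zero_lt_iff.mpr hc)
      rwa [map_pow w' β] at this
  -- Over the algebraic closure `T` is the product of the `q - r`, `r` a root of `P`. Each factor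
  -- has value `max (w q) (w r)`, and the product of these bounds every term of the Gauss value.
  have hbig : w (c j) * w q ^ j ≤ w T := by
    set p := P.map (algebraMap K Kbar) with hp
    have hsplit := (IsAlgClosed.splits p).eq_prod_roots_of_monic ((minpoly.monic hb).map _)
    have hTp : T = (p.roots.map fun r => q - algebraMap Kbar (RatFunc Kbar) r).prod := by
      have e : T = aeval q p := by
        rw [hT, hp, aeval_map_algebraMap, aeval_eq_sum_range]
        refine Finset.sum_congr rfl fun i _ => ?_
        rw [Algebra.smul_def]
      rw [e]
      conv_lhs => rw [hsplit]
      rw [map_multiset_prod, Multiset.map_map]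
      congr 1
      refine Multiset.map_congr rfl fun r _ => ?_
      simp
    have hroot : (Q.map (algebraMap K Kbar)).eval a = 0 := by
      rw [eval_map_algebraMap]
      exact minpoly.aeval K a
    have hval : w T = (p.roots.map fun r => max (w q) (w (algebraMap Kbar (RatFunc Kbar) r))).prod := by
      rw [hTp, map_multiset_prod, Multiset.map_map]
      congr 1
      refine Multiset.map_congr rfl fun r _ => ?_
      have := h.1.map_sub_C hroot r
      rwa [← ratFuncInclusion_algebraMap] at this
    have := (w.comap (algebraMap Kbar (RatFunc Kbar))).coeff_multiset_prod_X_sub_C_le (w q) p.roots j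
    rw [← hsplit, hp, coeff_map, Valuation.comap_apply, ← IsScalarTower.algebraMap_apply] at this
    rw [hval]
    exact this
  have : w T = w' T := hww' _
  have hq' : w q = w' q := hww' _
  rw [this, hq', hqβ, ← hcw] at hbig
  exact absurd hsmall (not_lt.mpr hbig)

/-! ### Value group and residue field of `K(a)` in terms of `ω` -/

theorem finiteDimensional_simpleExt (a : Kbar) : FiniteDimensional K (simpleExt K a) := by
  have ha := IsAlgClosure.isIntegral (K := K) a
  exact adjoin.finiteDimensional (ha.map (IsScalarTower.toAlgHom K Kbar (RatFunc Kbar)))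

theorem mem_simpleExt_iff {a : Kbar} {u : RatFunc Kbar} :
    u ∈ simpleExt K a ↔ ∃ f : K[X], f.natDegree < Module.finrank K K⟮a⟯ ∧
      algebraMap Kbar (RatFunc Kbar) (aeval a f) = u := by
  have ha := IsAlgClosure.isIntegral (K := K) a
  rw [simpleExt_eq_map, IntermediateField.mem_map, adjoin.finrank ha]
  constructor
  · rintro ⟨y, hy, rfl⟩
    rw [← IntermediateField.mem_toSubalgebra,
      adjoin_simple_toSubalgebra_of_isAlgebraic ha.isAlgebraic,
      Algebra.adjoin_singleton_eq_range_aeval] at hy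
    obtain ⟨f, rfl⟩ := hy
    refine ⟨f %ₘ minpoly K a, natDegree_modByMonic_lt _ (minpoly.monic ha) (minpoly.ne_one K a), ?_⟩
    rw [aeval_modByMonic_eq_self_of_root (minpoly.aeval K a)]
    rfl
  · rintro ⟨f, -, rfl⟩
    exact ⟨aeval a f, algebra_adjoin_le_adjoin K {a} (aeval_mem_adjoin_singleton K a), rfl⟩

/-- The right-hand side involves `a` only through its degree; this is what makes two minimal pairs
comparable. -/
theorem IsMinimalPair.mem_valueGroupOf_iff {ω : Valuation (RatFunc K) Γ₀}
    {w : Valuation (RatFunc Kbar) Γ₀} {a : Kbar} {γ : Γ₀} (h : IsMinimalPair K w a γ)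
    (hw : w.comap (ratFuncInclusion K Kbar) = ω) {g : Γ₀ˣ} :
    g ∈ valueGroupOf w (simpleExt K a) ↔ ∃ f : K[X], f.natDegree < Module.finrank K K⟮a⟯ ∧
      ω (algebraMap K[X] (RatFunc K) f) = g := by
  subst hw
  rw [_root_.mem_valueGroupOf_iff]
  simp only [mem_simpleExt_iff]
  have key : ∀ f : K[X], f.natDegree < Module.finrank K K⟮a⟯ →
      w (ratFuncInclusion K Kbar (algebraMap K[X] (RatFunc K) f)) =
        w (algebraMap Kbar (RatFunc Kbar) (aeval a f)) := fun f hf => by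
    by_cases hf0 : f = 0
    · simp [hf0]
    · exact w.map_eq_of_sub_lt (h.map_sub_aeval_lt hf0 hf)
  constructor
  · rintro ⟨_, ⟨f, hf, rfl⟩, e⟩
    exact ⟨f, hf, (key f hf).trans e⟩
  · rintro ⟨f, hf, e⟩
    exact ⟨_, ⟨f, hf, rfl⟩, (key f hf).symm.trans e⟩

theorem IsMinimalPair.coe_residueFieldOf {ω : Valuation (RatFunc K) Γ₀}
    {w : Valuation (RatFunc Kbar) Γ₀} {a : Kbar} {γ : Γ₀} (h : IsMinimalPair K w a γ)
    (hw : w.comap (ratFuncInclusion K Kbar) = ω) :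
    (residueFieldOf w (simpleExt K a) : Set (IsLocalRing.ResidueField w.valuationSubring)) =
      residueMap ω w (ratFuncInclusion K Kbar) hw '' (IsLocalRing.residue ω.valuationSubring ''
        {t | ∃ f : K[X], f.natDegree < Module.finrank K K⟮a⟯ ∧
          algebraMap K[X] (RatFunc K) f = t}) := by
  subst hw
  have key : ∀ f : K[X], f.natDegree < Module.finrank K K⟮a⟯ →
      w (ratFuncInclusion K Kbar (algebraMap K[X] (RatFunc K) f)) =
        w (algebraMap Kbar (RatFunc Kbar) (aeval a f)) ∧
      ∀ s t : w.valuationSubring,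
        ratFuncInclusion K Kbar (algebraMap K[X] (RatFunc K) f) = s →
        algebraMap Kbar (RatFunc Kbar) (aeval a f) = t →
        IsLocalRing.residue _ s = IsLocalRing.residue _ t := fun f hf => by
    by_cases hf0 : f = 0
    · refine ⟨by simp [hf0], fun s t hs ht => ?_⟩
      congr 1
      apply Subtype.ext
      rw [← hs, ← ht]
      simp [hf0]
    · have hlt := h.map_sub_aeval_lt hf0 hf
      refine ⟨w.map_eq_of_sub_lt hlt, fun s t hs ht => residue_eq_of_sub_lt ?_⟩
      -- Here `w (s - t) < w t ≤ 1`, so the residues agree.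
      rw [hs, ht] at hlt
      exact hlt.trans_le t.2
  ext z
  rw [SetLike.mem_coe, mem_residueFieldOf_iff]
  constructor
  · rintro ⟨u, hu, rfl⟩
    obtain ⟨f, hf, e⟩ := mem_simpleExt_iff.mp hu
    have hle : w (ratFuncInclusion K Kbar (algebraMap K[X] (RatFunc K) f)) ≤ 1 := by
      rw [(key f hf).1, e]
      exact u.2
    exact ⟨_, ⟨⟨algebraMap K[X] (RatFunc K) f, hle⟩, ⟨f, hf, rfl⟩, rfl⟩,
      (key f hf).2 _ _ rfl e⟩
  · rintro ⟨_, ⟨t, ⟨f, hf, e⟩, rfl⟩, rfl⟩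
    have hle : w (algebraMap Kbar (RatFunc Kbar) (aeval a f)) ≤ 1 := by
      rw [← (key f hf).1, e]
      exact t.2
    refine ⟨⟨_, hle⟩, mem_simpleExt_iff.mpr ⟨f, hf, rfl⟩, ?_⟩
    exact ((key f hf).2 _ _ (congrArg (ratFuncInclusion K Kbar) e) rfl).symm

end MinimalPairs

/-! ### Transport of subfields along field embeddings -/

section SubfieldMap

variable {R E : Type*} [Field R] [Field E]

/-- `T` is only a set, but by injectivity of `ι` it is the preimage of the subfield `B`, hence a
subfield, and it serves for both embeddings. -/
theorem Subfield.exists_map_eq_of_coe_eq_image {E' : Type*} [Field E'] (ι : R →+* E)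
    (ι' : R →+* E') {B : Subfield E} {B' : Subfield E'} {T : Set R} (h : (B : Set E) = ι '' T)
    (h' : (B' : Set E') = ι' '' T) : ∃ k : Subfield R, k.map ι = B ∧ k.map ι' = B' := by
  have hk : (B.comap ι : Set R) = T := by
    rw [Subfield.coe_comap, h, Set.preimage_image_eq _ ι.injective]
  exact ⟨B.comap ι, SetLike.coe_injective (by rw [Subfield.coe_map, hk, h]),
    SetLike.coe_injective (by rw [Subfield.coe_map, hk, h'])⟩

theorem Subfield.map_inj (ι : R →+* E) {k₀ k : Subfield R} : k₀.map ι = k.map ι ↔ k₀ = k :=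
  ⟨fun h => by rw [← k₀.comap_map ι, h, Subfield.comap_map], fun h => by rw [h]⟩

theorem Subfield.ringChar_map (ι : R →+* E) (k : Subfield R) :
    ringChar (k.map ι) = ringChar k := by
  let e := k.toSubring.equivMapOfInjective ι ι.injective
  have := ringChar.charP k
  exact (ringChar.eq_iff (R := k.map ι)).mpr (charP_of_injective_ringHom (R := k) (A := k.map ι)
    (f := e.toRingHom) e.injective (ringChar k))

theorem Subfield.isSeparable_extendScalars_map_iff (ι : R →+* E) {k₀ k : Subfield R} (h : k₀ ≤ k)
    {A B : Subfield E} (hA : k₀.map ι = A) (hB : k.map ι = B) (hAB : A ≤ B) :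
    Algebra.IsSeparable A (Subfield.extendScalars hAB) ↔
      Algebra.IsSeparable k₀ (Subfield.extendScalars h) := by
  subst hA hB
  let e₀ : k₀ ≃+* k₀.map ι := k₀.toSubring.equivMapOfInjective ι ι.injective
  let e : Subfield.extendScalars h ≃+* Subfield.extendScalars hAB :=
    k.toSubring.equivMapOfInjective ι ι.injective
  exact (Algebra.IsSeparable.iff_of_equiv_equiv e₀ e rfl).symm

/-- An elementwise criterion inside `E`, which passes directly through an embedding. -/
theorem Subfield.isPurelyInseparable_extendScalars_iff {A B : Subfield E} (h : A ≤ B) :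
    IsPurelyInseparable A (Subfield.extendScalars h) ↔
      ∀ x ∈ B, ∃ n : ℕ, x ^ ringExpChar A ^ n ∈ A := by
  rw [isPurelyInseparable_iff_pow_mem A (ringExpChar A)]
  constructor
  · intro H x hx
    obtain ⟨n, y, hy⟩ := H ⟨x, hx⟩
    refine ⟨n, ?_⟩
    have : (y : E) = x ^ ringExpChar A ^ n := congrArg Subtype.val hy
    rw [← this]
    exact y.2
  · intro H x
    obtain ⟨n, hn⟩ := H x x.2
    exact ⟨n, ⟨_, hn⟩, Subtype.ext rfl⟩

theorem Subfield.isPurelyInseparable_extendScalars_map_iff (ι : R →+* E) {k₀ k : Subfield R}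
    (h : k₀ ≤ k) {A B : Subfield E} (hA : k₀.map ι = A) (hB : k.map ι = B) (hAB : A ≤ B) :
    IsPurelyInseparable A (Subfield.extendScalars hAB) ↔
      IsPurelyInseparable k₀ (Subfield.extendScalars h) := by
  subst hA hB
  rw [Subfield.isPurelyInseparable_extendScalars_iff, Subfield.isPurelyInseparable_extendScalars_iff]
  have hq : ringExpChar (k₀.map ι) = ringExpChar k₀ := by
    rw [ringExpChar, ringExpChar, Subfield.ringChar_map]
  have hmem : ∀ x : R, ι x ∈ k₀.map ι ↔ x ∈ k₀ := fun x => by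
    rw [← Subfield.mem_comap, Subfield.comap_map]
  rw [hq]
  constructor
  · intro H x hx
    obtain ⟨n, hn⟩ := H (ι x) ⟨x, hx, rfl⟩
    exact ⟨n, (hmem _).mp (by rwa [map_pow])⟩
  · rintro H _ ⟨x, hx, rfl⟩
    obtain ⟨n, hn⟩ := H x hx
    exact ⟨n, by rw [← map_pow]; exact (hmem _).mpr hn⟩

end SubfieldMap

theorem isPGroup_quotient_congr {G : Type*} [CommGroup G] {p p' : ℕ} {A A' B B' : Subgroup G}
    (hp : p = p') (hA : A = A') (hB : B = B') :
    IsPGroup p (B ⧸ A.subgroupOf B) ↔ IsPGroup p' (B' ⧸ A'.subgroupOf B') := by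
  subst hp hA hB
  rfl

/-! ### Properties determined by value groups, residue fields and degree -/

section Transfer

variable {Γ₀ : Type*} [LinearOrderedCommGroupWithZero Γ₀] {K F F' R : Type*} [Field K] [Field F]
  [Field F'] [Algebra K F] [Algebra K F'] [Field R] {v : Valuation F Γ₀} {v' : Valuation F' Γ₀}
  {L : IntermediateField K F} {L' : IntermediateField K F'}

/-- Subextensions `L` of `(F | K, v)` and `L'` of `(F' | K, v')` with the same value groups, and
with residue fields that are images of the same subfields of a field embedded in both residue fields
`F v` and `F' v'`. -/
structure SameValueGroupAndResidueField (ι : R →+* IsLocalRing.ResidueField v.valuationSubring)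
    (ι' : R →+* IsLocalRing.ResidueField v'.valuationSubring) (L : IntermediateField K F)
    (L' : IntermediateField K F') (k₀ k : Subfield R) : Prop where
  valueGroupOf_bot : valueGroupOf v (⊥ : IntermediateField K F) =
    valueGroupOf v' (⊥ : IntermediateField K F')
  valueGroupOf_eq : valueGroupOf v L = valueGroupOf v' L'
  map_bot : k₀.map ι = residueFieldOf v (⊥ : IntermediateField K F)
  map_bot' : k₀.map ι' = residueFieldOf v' (⊥ : IntermediateField K F')
  map_eq : k.map ι = residueFieldOf v L
  map_eq' : k.map ι' = residueFieldOf v' L'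

namespace SameValueGroupAndResidueField

variable {ι : R →+* IsLocalRing.ResidueField v.valuationSubring}
  {ι' : R →+* IsLocalRing.ResidueField v'.valuationSubring} {k₀ k : Subfield R}

theorem le (H : SameValueGroupAndResidueField ι ι' L L' k₀ k) : k₀ ≤ k := by
  intro x hx
  have : ι x ∈ k.map ι := by
    rw [H.map_eq]
    refine residueFieldOf_mono v bot_le ?_
    rw [← H.map_bot]
    exact ⟨x, hx, rfl⟩
  rwa [← Subfield.mem_comap, Subfield.comap_map] at this

theorem ramificationIndex_eq (H : SameValueGroupAndResidueField ι ι' L L' k₀ k) :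
    ramificationIndex v L = ramificationIndex v' L' := by
  rw [ramificationIndex, ramificationIndex, H.valueGroupOf_bot, H.valueGroupOf_eq]

theorem inertiaDegree_eq (H : SameValueGroupAndResidueField ι ι' L L' k₀ k) :
    inertiaDegree v L = inertiaDegree v' L' := by
  rw [inertiaDegree_eq_relfinrank, inertiaDegree_eq_relfinrank, ← H.map_bot, ← H.map_bot',
    ← H.map_eq, ← H.map_eq', Subfield.relfinrank_map_map, Subfield.relfinrank_map_map]

theorem ringChar_eq (H : SameValueGroupAndResidueField ι ι' L L' k₀ k) :
    ringChar (residueFieldOf v (⊥ : IntermediateField K F)) =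
    ringChar (residueFieldOf v' (⊥ : IntermediateField K F')) := by
  rw [← H.map_bot, ← H.map_bot', Subfield.ringChar_map, Subfield.ringChar_map]

theorem isImmediateExt_iff (H : SameValueGroupAndResidueField ι ι' L L' k₀ k) :
    IsImmediateExt v L ↔ IsImmediateExt v' L' := by
  rw [IsImmediateExt, IsImmediateExt, H.valueGroupOf_bot, H.valueGroupOf_eq, ← H.map_bot,
    ← H.map_bot', ← H.map_eq, ← H.map_eq', Subfield.map_inj, Subfield.map_inj]

theorem isSeparable_iff (H : SameValueGroupAndResidueField ι ι' L L' k₀ k) :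
    Algebra.IsSeparable (residueFieldOf v (⊥ : IntermediateField K F)) (residueExtension v L) ↔
      Algebra.IsSeparable (residueFieldOf v' (⊥ : IntermediateField K F'))
        (residueExtension v' L') :=
  (Subfield.isSeparable_extendScalars_map_iff ι H.le H.map_bot H.map_eq _).trans
    (Subfield.isSeparable_extendScalars_map_iff ι' H.le H.map_bot' H.map_eq' _).symm

theorem isPurelyInseparable_iff (H : SameValueGroupAndResidueField ι ι' L L' k₀ k) :
    IsPurelyInseparable (residueFieldOf v (⊥ : IntermediateField K F)) (residueExtension v L) ↔
      IsPurelyInseparable (residueFieldOf v' (⊥ : IntermediateField K F'))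
        (residueExtension v' L') :=
  (Subfield.isPurelyInseparable_extendScalars_map_iff ι H.le H.map_bot H.map_eq _).trans
    (Subfield.isPurelyInseparable_extendScalars_map_iff ι' H.le H.map_bot' H.map_eq' _).symm

variable [FiniteDimensional K L] [FiniteDimensional K L']

theorem isPurelyWildExt_iff (H : SameValueGroupAndResidueField ι ι' L L' k₀ k) :
    IsPurelyWildExt v L ↔ IsPurelyWildExt v' L' := by
  have hp : ringExpChar (residueFieldOf v (⊥ : IntermediateField K F)) =
      ringExpChar (residueFieldOf v' (⊥ : IntermediateField K F')) := by
    rw [ringExpChar, ringExpChar, H.ringChar_eq]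
  exact and_congr (iff_of_true inferInstance inferInstance) (and_congr
    (isPGroup_quotient_congr hp H.valueGroupOf_bot H.valueGroupOf_eq) H.isPurelyInseparable_iff)

theorem isDefectlessExt_iff (H : SameValueGroupAndResidueField ι ι' L L' k₀ k)
    (hn : Module.finrank K L = Module.finrank K L') :
    IsDefectlessExt v L ↔ IsDefectlessExt v' L' := by
  rw [IsDefectlessExt, IsDefectlessExt, H.ramificationIndex_eq, H.inertiaDegree_eq, hn]
  exact and_congr_left' (iff_of_true inferInstance inferInstance)

theorem isTameExt_iff (H : SameValueGroupAndResidueField ι ι' L L' k₀ k)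
    (hn : Module.finrank K L = Module.finrank K L') :
    IsTameExt v L ↔ IsTameExt v' L' := by
  rw [isTameExt_iff_of_finite, isTameExt_iff_of_finite, H.isDefectlessExt_iff hn, H.isSeparable_iff,
    H.ringChar_eq, H.ramificationIndex_eq]

end SameValueGroupAndResidueField

end Transfer

/-! ### Comparison of two minimal fields of definition -/

section MinimalFieldsOfDefinition

variable {K Kbar Γ₀ : Type*} [Field K] [Field Kbar] [Algebra K Kbar] [IsAlgClosure K Kbar]
  [LinearOrderedCommGroupWithZero Γ₀] {ω : Valuation (RatFunc K) Γ₀}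
  {w w' : Valuation (RatFunc Kbar) Γ₀} {a a' : Kbar} {γ γ' : Γ₀}

theorem IsMinimalPair.finrank_eq (hw : w.comap (ratFuncInclusion K Kbar) = ω)
    (hw' : w'.comap (ratFuncInclusion K Kbar) = ω) (h : IsMinimalPair K w a γ)
    (h' : IsMinimalPair K w' a' γ') :
    Module.finrank K K⟮a⟯ = Module.finrank K K⟮a'⟯ :=
  le_antisymm (h'.finrank_le hw' hw h) (h.finrank_le hw hw' h')

theorem IsMinimalPair.exists_sameValueGroupAndResidueField
    (hw : w.comap (ratFuncInclusion K Kbar) = ω) (hw' : w'.comap (ratFuncInclusion K Kbar) = ω)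
    (h : IsMinimalPair K w a γ) (h' : IsMinimalPair K w' a' γ') :
    ∃ k₀ k, SameValueGroupAndResidueField (residueMap ω w (ratFuncInclusion K Kbar) hw)
      (residueMap ω w' (ratFuncInclusion K Kbar) hw') (simpleExt K a) (simpleExt K a') k₀ k := by
  have hn := h.finrank_eq hw hw' h'
  have hr := h.coe_residueFieldOf hw
  -- Equality of the degrees makes both residue fields images of one and the same subset of `K(x)ω`.
  rw [hn] at hr
  obtain ⟨k, hk, hk'⟩ :=
    Subfield.exists_map_eq_of_coe_eq_image _ _ hr (h'.coe_residueFieldOf hw')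
  obtain ⟨k₀, hk₀, hk₀'⟩ := Subfield.exists_map_eq_of_coe_eq_image _ _
    (coe_residueFieldOf_bot hw) (coe_residueFieldOf_bot hw')
  refine ⟨k₀, k, ?_, ?_, hk₀, hk₀', hk, hk'⟩
  · ext g
    rw [mem_valueGroupOf_bot_iff hw, mem_valueGroupOf_bot_iff hw']
  · ext g
    rw [h.mem_valueGroupOf_iff hw, h'.mem_valueGroupOf_iff hw', hn]

end MinimalFieldsOfDefinition

theorem proposition4p2 {K Kbar Γ₀ : Type*} [Field K] [Field Kbar] [Algebra K Kbar]
    [IsAlgClosure K Kbar] [LinearOrderedCommGroupWithZero Γ₀]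
    (ν : Valuation K Γ₀) (ω : Valuation (RatFunc K) Γ₀)
    (hω : ω.comap (algebraMap K (RatFunc K)) = ν)
    (w w' : Valuation (RatFunc Kbar) Γ₀)
    (hw : w.comap (ratFuncInclusion K Kbar) = ω)
    (hw' : w'.comap (ratFuncInclusion K Kbar) = ω)
    (a a' : Kbar) (γ γ' : Γ₀)
    (h : IsMinimalPair K w a γ) (h' : IsMinimalPair K w' a' γ') :
    -- equality of the ramification indices
    ramificationIndex w (simpleExt K a) = ramificationIndex w' (simpleExt K a') ∧
    -- the residue fields of `K(a)` and `K(a')` are one and the same subfield `k` of `K(x)ω`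
    (∃ k : Subfield (IsLocalRing.ResidueField ω.valuationSubring),
      k.map (residueMap ω w (ratFuncInclusion K Kbar) hw) = residueFieldOf w (simpleExt K a) ∧
      k.map (residueMap ω w' (ratFuncInclusion K Kbar) hw') =
        residueFieldOf w' (simpleExt K a')) ∧
    (IsImmediateExt w (simpleExt K a) ↔ IsImmediateExt w' (simpleExt K a')) ∧
    (HenselianLocalRing ν.valuationSubring →
      (IsDefectlessExt w (simpleExt K a) ↔ IsDefectlessExt w' (simpleExt K a')) ∧
      (IsTameExt w (simpleExt K a) ↔ IsTameExt w' (simpleExt K a')) ∧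
      (IsPurelyWildExt w (simpleExt K a) ↔ IsPurelyWildExt w' (simpleExt K a'))) := by
  have := finiteDimensional_simpleExt (K := K) a
  have := finiteDimensional_simpleExt (K := K) a'
  have hn : Module.finrank K (simpleExt K a) = Module.finrank K (simpleExt K a') := by
    rw [finrank_simpleExt, finrank_simpleExt, h.finrank_eq hw hw' h']
  obtain ⟨k₀, k, H⟩ := h.exists_sameValueGroupAndResidueField hw hw' h'
  exact ⟨H.ramificationIndex_eq, ⟨k, H.map_eq, H.map_eq'⟩, H.isImmediateExt_iff,
    fun _ => ⟨H.isDefectlessExt_iff hn, H.isTameExt_iff hn, H.isPurelyWildExt_iff⟩⟩
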